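/- Let $0<\alpha<1$, $B\ge 1$, $L_0>0$, and $L_j=(B+1)L_{j-1}$ for $j=1,\dots,J$. For $t\ge 0$ and $1\le j\le J$ put $\Delta L_j=L_j-L_{j-1}$ and $$I_j=\frac1{\Gamma(1-\alpha)}\int_{L_{j-1}}^{L_j}x^{-\alpha}e^{-xt}\,dx=\int_{-1}^1 f_j(y)\,dy,$$ $$f_j(y)=\frac{\Delta L_j}{2\Gamma(1-\alpha)}\,e^{-L_{j-1}t}\Bigl(L_{j-1}+\tfrac{\Delta L_j}{2}(y+1)\Bigr)^{-\alpha}e^{-t(y+1)\Delta L_j/2}.$$ For $Q\ge1$ let $I_Qf_j=\sum_{i=1}^Q w_if_j(x_i)$ be the $Q$-point Gauss(-Legendre) quadrature of $f_j$ on $[-1,1]$ (the nodes $x_i$ are the zeros of the Legendre polynomial of degree $Q$, and $w_i$ is the integral over $[-1,1]$ of the corresponding Lagrange basis polynomial), and let $\tau_j(Q)=\int_{-1}^1 f_j(y)\,dy-I_Qf_j$ be its error. Then $$|\tau_j(Q)|\le\frac{4B\,L_{j-1}^{1-\alpha}}{\Gamma(1-\alpha)}\min_{0<\varepsilon<1}\frac{g(\varepsilon,B)^{-2Q+1}}{g(\varepsilon,B)-1}\,\varepsilon^{-\alpha}e^{-tL_{j-1}\varepsilon},$$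 where the minimum is attained and $$g(\varepsilon,B)=1+\frac2B(1-\varepsilon)+\sqrt{\Bigl(1+\frac2B(1-\varepsilon)\Bigr)^2-1}.$$ -/

import Mathlib

namespace GaussLegendre

/-- The Legendre polynomial of degree `Q` (Rodrigues' formula). -/
noncomputable def legendre (Q : ℕ) : Polynomial ℝ :=
  Polynomial.C (1 / ((2 : ℝ) ^ Q * (Nat.factorial Q : ℝ))) *
    Polynomial.derivative^[Q] ((Polynomial.X ^ 2 - 1) ^ Q)

/-- The nodes of the `Q`-point Gauss rule on `[-1, 1]` for the weight `w ≡ 1`: the zeros of the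
Legendre polynomial of degree `Q`. -/
noncomputable def nodes (Q : ℕ) : Finset ℝ :=
  (legendre Q).roots.toFinset

/-- The weight of the `Q`-point Gauss rule at the node `x`: the integral over `[-1, 1]` of the
Lagrange basis polynomial which is `1` at `x` and `0` at the other nodes. -/
noncomputable def weight (Q : ℕ) (x : ℝ) : ℝ :=
  ∫ y in (-1 : ℝ)..1, (Lagrange.basis (nodes Q) id x).eval y

/-- The `Q`-point Gauss quadrature `I_Q f` on `[-1, 1]` (weight function `w ≡ 1`). -/
noncomputable def quad (Q : ℕ) (f : ℝ → ℝ) : ℝ :=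
  ∑ x ∈ nodes Q, weight Q x * f x

/-- The quadrature error `I f - I_Q f`, where `I f` is the integral of `f` over `[-1, 1]`. -/
noncomputable def error (Q : ℕ) (f : ℝ → ℝ) : ℝ :=
  (∫ y in (-1 : ℝ)..1, f y) - quad Q f

end GaussLegendre

/-- The integral `(1 / Γ(1 - α)) ∫_a^b x ^ (-α) e ^ (-x t) dx`. -/
noncomputable def kernelIntegral (α t a b : ℝ) : ℝ :=
  1 / Real.Gamma (1 - α) * ∫ x in a..b, x ^ (-α) * Real.exp (-x * t)

/-- The integrand of `kernelIntegral α t a b` (with its constant factor) after the affine change of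
variables `x = a + (b - a) / 2 * (y + 1)` to the reference interval `[-1, 1]`. -/
noncomputable def referenceIntegrand (α t a b y : ℝ) : ℝ :=
  (b - a) / (2 * Real.Gamma (1 - α)) * Real.exp (-a * t) *
    (a + (b - a) / 2 * (y + 1)) ^ (-α) * Real.exp (-t * (y + 1) * (b - a) / 2)

/-- `g(ε, B) = 1 + (2 / B) (1 - ε) + √((1 + (2 / B) (1 - ε))² - 1)`. -/
noncomputable def gFun (ε B : ℝ) : ℝ :=
  1 + 2 / B * (1 - ε) + Real.sqrt ((1 + 2 / B * (1 - ε)) ^ 2 - 1)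

/-- The quantity minimised over `0 < ε < 1` in the error bound; `l` is the left endpoint of the
integration interval. -/
noncomputable def errorFactor (α B t l : ℝ) (Q : ℕ) (ε : ℝ) : ℝ :=
  gFun ε B ^ (-2 * (Q : ℤ) + 1) / (gFun ε B - 1) * ε ^ (-α) * Real.exp (-t * l * ε)

/-! ### Zeros of the derivatives of `(X ^ 2 - 1) ^ Q`. -/

section

open Polynomial

/-! The Gauss rule is exact in degree below `2Q` and has nonnegative weights of sum 2. So its error
is at most 4 on every Chebyshev polynomial `T k`, and zero if `|k| < 2Q`. Expanding powers of `y`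
through `2 y T k = T (k+1) + T (k-1)` gives an error of at most `8 ρ^(-2Q) R^n` on `(-y)^n`, where
`R = (ρ + ρ⁻¹)/2` (`abs_error_neg_pow_le`). The integrand is a series in powers of `-y` with
nonnegative coefficients, so summing gives `8 ρ^(-2Q) f(-R)` (`abs_error_le_of_hasSum`), with no
complex analysis on ellipses. For `ρ = g(ε, B)`, the point `-R` corresponds to `x = L_{j-1} ε`, and
`f(-R)` is explicit. The bound holds for every `ε`, hence at the minimiser. -/

theorem iterate_derivative_X_sq_sub_one_pow_ne_zero (Q k : ℕ) (hk : k ≤ 2 * Q) :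
    derivative^[k] ((X ^ 2 - 1 : ℝ[X]) ^ Q) ≠ 0 := by
  have hm : ((X ^ 2 - 1 : ℝ[X]) ^ Q).natDegree = Q * 2 := by
    rw [natDegree_pow, ← C_1, natDegree_X_pow_sub_C]
  have hmon : ((X ^ 2 - 1 : ℝ[X]) ^ Q).Monic := by
    refine Monic.pow ?_ Q
    rw [← C_1]
    exact monic_X_pow_sub_C 1 two_ne_zero
  intro h
  have := congrArg (fun p => coeff p (Q * 2 - k)) h
  simp only [coeff_iterate_derivative, coeff_zero] at this
  rw [Nat.sub_add_cancel (by omega), ← hm, coeff_natDegree, hmon.leadingCoeff, hm] at this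
  have h2 : (Q * 2).descFactorial k ≠ 0 := by
    rw [Ne, Nat.descFactorial_eq_zero_iff_lt]; omega
  simp at this
  omega

theorem natDegree_iterate_derivative_X_sq_sub_one_pow_le (Q : ℕ) :
    (derivative^[Q] ((X ^ 2 - 1 : ℝ[X]) ^ Q)).natDegree ≤ Q := by
  have hm : ((X ^ 2 - 1 : ℝ[X]) ^ Q).natDegree = Q * 2 := by
    rw [natDegree_pow, ← C_1, natDegree_X_pow_sub_C]
  have := natDegree_iterate_derivative ((X ^ 2 - 1 : ℝ[X]) ^ Q) Q
  omega

theorem eval_iterate_derivative_X_sq_sub_one_pow {Q k : ℕ} (hk : k < Q) {x : ℝ} (hx : x ^ 2 = 1) :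
    (derivative^[k] ((X ^ 2 - 1 : ℝ[X]) ^ Q)).eval x = 0 := by
  have h := pow_sub_dvd_iterate_derivative_pow (X ^ 2 - 1 : ℝ[X]) Q k
  obtain ⟨r, hr⟩ := h
  rw [hr]
  have : Q - k ≠ 0 := by omega
  simp [hx, this]

/-- Induction by Rolle: `k + 2` roots yield `k + 1` new ones between them, and `±1` remain roots as
long as the order is below `Q`. -/
theorem card_roots_iterate_derivative_X_sq_sub_one_pow {Q k : ℕ} (hk : k < Q) :
    k + 2 ≤ (derivative^[k] ((X ^ 2 - 1 : ℝ[X]) ^ Q)).roots.toFinset.card := by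
  have hsub : ∀ k < Q, ({1, -1} : Finset ℝ) ⊆
      (derivative^[k] ((X ^ 2 - 1 : ℝ[X]) ^ Q)).roots.toFinset := by
    intro k hk x hx
    rw [Multiset.mem_toFinset, mem_roots (iterate_derivative_X_sq_sub_one_pow_ne_zero Q k (by omega))]
    apply eval_iterate_derivative_X_sq_sub_one_pow hk
    simp only [Finset.mem_insert, Finset.mem_singleton] at hx
    rcases hx with rfl | rfl <;> norm_num
  have hc : ({1, -1} : Finset ℝ).card = 2 := Finset.card_pair (by norm_num)
  induction k with
  | zero => simpa [hc] using Finset.card_le_card (hsub 0 hk)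
  | succ k ih =>
    have h1 := ih (by omega)
    have h2 := card_roots_toFinset_le_card_roots_derivative_sdiff_roots_succ
      (derivative^[k] ((X ^ 2 - 1 : ℝ[X]) ^ Q))
    rw [← Function.iterate_succ_apply' derivative k] at h2
    set S := (derivative^[k] ((X ^ 2 - 1 : ℝ[X]) ^ Q)).roots.toFinset
    set S' := (derivative^[k + 1] ((X ^ 2 - 1 : ℝ[X]) ^ Q)).roots.toFinset
    have hd : Disjoint (S' \ S) ({1, -1} : Finset ℝ) :=
      Finset.disjoint_of_subset_right (hsub k (by omega)) Finset.sdiff_disjoint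
    have h3 : (S' \ S) ∪ ({1, -1} : Finset ℝ) ⊆ S' :=
      Finset.union_subset Finset.sdiff_subset (hsub (k + 1) hk)
    have h4 := Finset.card_le_card h3
    rw [Finset.card_union_of_disjoint hd, hc] at h4
    omega

/-- Gauss–Lucas over `ℂ`: the convex strip `-1 ≤ re z ≤ 1` contains the roots `±1`, hence those of
all derivatives. -/
theorem mem_Icc_of_isRoot_iterate_derivative_X_sq_sub_one_pow {Q k : ℕ} (hk : k ≤ Q) {x : ℝ}
    (hx : (derivative^[k] ((X ^ 2 - 1 : ℝ[X]) ^ Q)).IsRoot x) : x ∈ Set.Icc (-1 : ℝ) 1 := by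
  rcases Nat.eq_zero_or_pos Q with rfl | hQ
  · obtain rfl : k = 0 := by omega
    simp at hx
  have hconv : Convex ℝ {z : ℂ | z.re ∈ Set.Icc (-1 : ℝ) 1} :=
    (convex_Icc (-1 : ℝ) 1).linear_preimage Complex.reLm
  have key : ∀ k ≤ Q, (derivative^[k] ((X ^ 2 - 1 : ℂ[X]) ^ Q)).rootSet ℂ ⊆
      {z : ℂ | z.re ∈ Set.Icc (-1 : ℝ) 1} := by
    intro k
    induction k with
    | zero =>
      intro _ z hz
      have h := (mem_rootSet.1 hz).2
      have h' : z ^ 2 = 1 := by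
        have : z ^ 2 - 1 = 0 := by
          simpa [hQ.ne'] using h
        linear_combination this
      rcases (sq_eq_sq_iff_eq_or_eq_neg.1 (h'.trans (one_pow 2).symm)) with rfl | rfl <;> simp
    | succ k ih =>
      intro hk
      rw [Function.iterate_succ_apply']
      rcases le_or_gt (derivative^[k] ((X ^ 2 - 1 : ℂ[X]) ^ Q)).degree 0 with h0 | h0
      · rw [eq_C_of_degree_le_zero h0]
        simp
      · exact (rootSet_derivative_subset_convexHull_rootSet h0).trans
          (convexHull_min (ih (by omega)) hconv)
  have hmap : (derivative^[k] ((X ^ 2 - 1 : ℝ[X]) ^ Q)).map Complex.ofRealHom =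
      derivative^[k] ((X ^ 2 - 1 : ℂ[X]) ^ Q) := by
    rw [← iterate_derivative_map]; simp
  have hmem : (x : ℂ) ∈ (derivative^[k] ((X ^ 2 - 1 : ℂ[X]) ^ Q)).rootSet ℂ := by
    rw [mem_rootSet, ← hmap]
    refine ⟨(Polynomial.map_ne_zero_iff Complex.ofRealHom.injective).2
      (iterate_derivative_X_sq_sub_one_pow_ne_zero Q k (by omega)), ?_⟩
    rw [coe_aeval_eq_eval, eval_map, ← Complex.ofRealHom_eq_coe, eval₂_hom, hx]
    simp
  simpa using key k hk hmem

/-! ### The Gauss–Legendre rule: nodes, exactness, positivity. -/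

namespace GaussLegendre

theorem legendre_const_ne_zero (Q : ℕ) : 1 / ((2 : ℝ) ^ Q * (Nat.factorial Q : ℝ)) ≠ 0 := by
  positivity

theorem legendre_ne_zero (Q : ℕ) : legendre Q ≠ 0 :=
  mul_ne_zero (C_ne_zero.2 (legendre_const_ne_zero Q))
    (iterate_derivative_X_sq_sub_one_pow_ne_zero Q Q (by omega))

theorem roots_legendre (Q : ℕ) :
    (legendre Q).roots = (derivative^[Q] ((X ^ 2 - 1 : ℝ[X]) ^ Q)).roots :=
  roots_C_mul _ (legendre_const_ne_zero Q)

theorem mem_nodes {Q : ℕ} {x : ℝ} : x ∈ nodes Q ↔ (legendre Q).IsRoot x := by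
  rw [nodes, Multiset.mem_toFinset, mem_roots (legendre_ne_zero Q)]

theorem natDegree_legendre_le (Q : ℕ) : (legendre Q).natDegree ≤ Q :=
  (natDegree_C_mul_le _ _).trans (natDegree_iterate_derivative_X_sq_sub_one_pow_le Q)

theorem card_nodes_le (Q : ℕ) : (nodes Q).card ≤ Q :=
  (Multiset.toFinset_card_le _).trans ((card_roots' _).trans (natDegree_legendre_le Q))

theorem card_nodes (Q : ℕ) : (nodes Q).card = Q := by
  refine le_antisymm (card_nodes_le Q) ?_
  rcases Q with _ | k
  · simp
  -- One last Rolle step from order `Q - 1`: the roots `±1` are no longer available, but the `Q` new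
  -- ones suffice.
  have h1 := card_roots_iterate_derivative_X_sq_sub_one_pow (Nat.lt_succ_self k)
  have h2 := card_roots_toFinset_le_card_roots_derivative_sdiff_roots_succ
      (derivative^[k] ((X ^ 2 - 1 : ℝ[X]) ^ (k + 1)))
  rw [← Function.iterate_succ_apply' derivative k] at h2
  have h3 := Finset.card_le_card (Finset.sdiff_subset
    (s := (derivative^[k.succ] ((X ^ 2 - 1 : ℝ[X]) ^ (k + 1))).roots.toFinset)
    (t := (derivative^[k] ((X ^ 2 - 1 : ℝ[X]) ^ (k + 1))).roots.toFinset))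
  rw [nodes, roots_legendre]
  simp only [Nat.succ_eq_add_one] at *
  omega

theorem natDegree_legendre (Q : ℕ) : (legendre Q).natDegree = Q := by
  refine le_antisymm (natDegree_legendre_le Q) ?_
  calc Q = (nodes Q).card := (card_nodes Q).symm
    _ ≤ _ := (Multiset.toFinset_card_le _).trans (card_roots' _)

theorem node_mem_Icc {Q : ℕ} {x : ℝ} (hx : x ∈ nodes Q) : x ∈ Set.Icc (-1 : ℝ) 1 := by
  rw [nodes, roots_legendre, Multiset.mem_toFinset] at hx
  exact mem_Icc_of_isRoot_iterate_derivative_X_sq_sub_one_pow le_rfl (isRoot_of_mem_roots hx)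

theorem intervalIntegrable_eval (p : ℝ[X]) (a b : ℝ) :
    IntervalIntegrable (fun y => p.eval y) MeasureTheory.volume a b :=
  p.continuous.intervalIntegrable a b

/-- Repeated integration by parts: derivatives of order below `Q` vanish at `±1`, and each step
lowers the degree of `q`. -/
theorem integral_legendre_mul_eq_zero {Q : ℕ} {q : ℝ[X]} (hq : q.degree < Q) :
    ∫ y in (-1 : ℝ)..1, (legendre Q * q).eval y = 0 := by
  have key : ∀ k ≤ Q, ∀ q : ℝ[X], q.degree < k →
      ∫ y in (-1 : ℝ)..1, (derivative^[k] ((X ^ 2 - 1 : ℝ[X]) ^ Q)).eval y * q.eval y = 0 := by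
    intro k
    induction k with
    | zero =>
      intro _ q hq
      have : q = 0 := by
        rw [← degree_eq_bot]; simpa using hq
      simp [this]
    | succ k ih =>
      intro hk q hq
      set p := derivative^[k] ((X ^ 2 - 1 : ℝ[X]) ^ Q) with hp
      have hparts := intervalIntegral.integral_deriv_mul_eq_sub (a := (-1 : ℝ)) (b := 1)
        (u := fun y => p.eval y) (v := fun y => q.eval y)
        (u' := fun y => p.derivative.eval y) (v' := fun y => q.derivative.eval y)
        (fun x _ => p.hasDerivAt x) (fun x _ => q.hasDerivAt x)
        (intervalIntegrable_eval _ _ _) (intervalIntegrable_eval _ _ _)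
      have h1 : p.eval 1 = 0 := eval_iterate_derivative_X_sq_sub_one_pow (by omega) (by norm_num)
      have h2 : p.eval (-1) = 0 := eval_iterate_derivative_X_sq_sub_one_pow (by omega) (by norm_num)
      rw [intervalIntegral.integral_add (f := fun y => p.derivative.eval y * q.eval y)
        (g := fun y => p.eval y * q.derivative.eval y)
        ((p.derivative.continuous.mul q.continuous).intervalIntegrable _ _)
        ((p.continuous.mul q.derivative.continuous).intervalIntegrable _ _), h1, h2] at hparts
      have hd : q.derivative.degree < k := by
        rcases eq_or_ne q 0 with rfl | hq0
        · simp
        · rcases eq_or_ne q.derivative 0 with h0 | h0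
          · simp [h0]
          · have := degree_derivative_lt hq0
            rw [degree_eq_natDegree h0] at this ⊢
            rw [degree_eq_natDegree hq0] at this hq
            norm_cast at *
            omega
      rw [ih (by omega) _ hd] at hparts
      rw [Function.iterate_succ_apply', ← hp]
      simpa using hparts
  have := key Q le_rfl q hq
  simp only [legendre, eval_mul, eval_C, mul_assoc]
  rw [intervalIntegral.integral_const_mul, this, mul_zero]

theorem quad_eval_of_degree_lt {Q : ℕ} {p : ℝ[X]} (hp : p.degree < Q) :
    quad Q (fun y => p.eval y) = ∫ y in (-1 : ℝ)..1, p.eval y := by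
  have h := Lagrange.eq_interpolate (s := nodes Q) (v := id) (f := p)
    (Function.injective_id.injOn) (by rwa [card_nodes])
  conv_rhs => rw [h]
  simp only [Lagrange.interpolate_apply, eval_finsetSum, eval_mul, eval_C, id]
  rw [intervalIntegral.integral_finsetSum]
  · refine Finset.sum_congr rfl fun x _ => ?_
    rw [intervalIntegral.integral_const_mul, weight, mul_comm]
  · intro i _
    exact (continuous_const.mul (Polynomial.continuous _)).intervalIntegrable _ _

/-- Divide by `legendre Q`: the multiple vanishes at the nodes and has integral zero by
orthogonality, leaving the remainder. -/
theorem quad_eval_of_degree_lt_two_mul {Q : ℕ} {p : ℝ[X]} (hp : p.degree < (2 * Q : ℕ)) :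
    quad Q (fun y => p.eval y) = ∫ y in (-1 : ℝ)..1, p.eval y := by
  have hdiv := EuclideanDomain.div_add_mod p (legendre Q)
  have hL : (legendre Q).degree = Q := by
    rw [degree_eq_natDegree (legendre_ne_zero Q), natDegree_legendre]
  have hr : (p % legendre Q).degree < Q := hL ▸ degree_mod_lt p (legendre_ne_zero Q)
  have hq : (p / legendre Q).degree < Q := by
    rcases eq_or_ne (p / legendre Q) 0 with h0 | h0
    · simp [h0]
    have hle : (legendre Q).degree ≤ p.degree := by
      by_contra hlt
      exact h0 ((Polynomial.div_eq_zero_iff (legendre_ne_zero Q)).2 (not_le.1 hlt))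
    have hadd := degree_add_div (legendre_ne_zero Q) hle
    have hp0 : p ≠ 0 := by
      rintro rfl
      simp at h0
    rw [hL, degree_eq_natDegree h0, degree_eq_natDegree hp0] at hadd
    rw [degree_eq_natDegree hp0] at hp
    rw [degree_eq_natDegree h0]
    norm_cast at *
    omega
  have h1 : quad Q (fun y => p.eval y) = quad Q (fun y => (p % legendre Q).eval y) := by
    refine Finset.sum_congr rfl fun x hx => ?_
    have hx0 : (legendre Q).eval x = 0 := mem_nodes.1 hx
    conv_lhs => rw [← hdiv]
    simp [hx0]
  rw [h1, quad_eval_of_degree_lt hr]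
  conv_rhs => rw [← hdiv]
  simp only [eval_add]
  rw [intervalIntegral.integral_add (intervalIntegrable_eval _ _ _)
    (intervalIntegrable_eval _ _ _), integral_legendre_mul_eq_zero hq, zero_add]

/-- The weight is the integral of the squared Lagrange basis polynomial, whose degree `2Q - 2` is
within exactness. -/
theorem weight_nonneg {Q : ℕ} {x : ℝ} (hx : x ∈ nodes Q) : 0 ≤ weight Q x := by
  set b := Lagrange.basis (nodes Q) id x with hb
  have hQ : 0 < Q := card_nodes Q ▸ Finset.card_pos.2 ⟨x, hx⟩
  have hdeg : b.degree = (Q - 1 : ℕ) := by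
    rw [hb, Lagrange.degree_basis Function.injective_id.injOn hx, card_nodes]
  have h := quad_eval_of_degree_lt_two_mul (Q := Q) (p := b * b) (by
    rw [degree_mul, hdeg]; norm_cast; omega)
  have hq : quad Q (fun y => (b * b).eval y) = weight Q x := by
    rw [quad, Finset.sum_eq_single_of_mem x hx]
    · have : b.eval x = 1 := Lagrange.eval_basis_self (v := id) Function.injective_id.injOn hx
      simp [this]
    · intro y hy hyx
      have : b.eval y = 0 := Lagrange.eval_basis_of_ne (v := id) (i := x) (j := y) hyx.symm hy
      simp [this]
  rw [← hq, h]
  refine intervalIntegral.integral_nonneg (by norm_num) fun y _ => ?_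
  simpa using mul_self_nonneg (b.eval y)

theorem sum_weight {Q : ℕ} (hQ : 1 ≤ Q) : ∑ x ∈ nodes Q, weight Q x = 2 := by
  have h := quad_eval_of_degree_lt (Q := Q) (p := 1) (by rw [degree_one]; exact_mod_cast hQ)
  simp only [quad, eval_one, mul_one, intervalIntegral.integral_const] at h
  rw [h]; norm_num

theorem abs_error_le {Q : ℕ} (hQ : 1 ≤ Q) {f : ℝ → ℝ} {C : ℝ}
    (hf : ∀ y ∈ Set.Icc (-1 : ℝ) 1, |f y| ≤ C) : |error Q f| ≤ 4 * C := by
  have h1 : |∫ y in (-1 : ℝ)..1, f y| ≤ 2 * C := by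
    have := intervalIntegral.norm_integral_le_of_norm_le_const (a := (-1 : ℝ)) (b := 1) (f := f)
      (C := C) (fun y hy => hf y (by
        rw [Set.uIoc_of_le (by norm_num)] at hy
        exact Set.Ioc_subset_Icc_self hy))
    rw [Real.norm_eq_abs] at this
    norm_num at this
    linarith
  have h2 : |quad Q f| ≤ 2 * C := by
    rw [← sum_weight hQ, Finset.sum_mul]
    refine (Finset.abs_sum_le_sum_abs _ _).trans (Finset.sum_le_sum fun x hx => ?_)
    rw [abs_mul, abs_of_nonneg (weight_nonneg hx)]
    exact mul_le_mul_of_nonneg_left (hf x (node_mem_Icc hx)) (weight_nonneg hx)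
  have := abs_sub (∫ y in (-1 : ℝ)..1, f y) (quad Q f)
  rw [error]
  linarith

theorem error_add {Q : ℕ} {f g : ℝ → ℝ} (hf : Continuous f) (hg : Continuous g) :
    error Q (fun y => f y + g y) = error Q f + error Q g := by
  simp only [error, quad, mul_add, Finset.sum_add_distrib]
  rw [intervalIntegral.integral_add (hf.intervalIntegrable _ _) (hg.intervalIntegrable _ _)]
  ring

theorem error_const_mul (Q : ℕ) (c : ℝ) (f : ℝ → ℝ) :
    error Q (fun y => c * f y) = c * error Q f := by
  simp only [error, quad, intervalIntegral.integral_const_mul, mul_sub, Finset.mul_sum]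
  congr 1
  exact Finset.sum_congr rfl fun x _ => by ring

/-! ### Quadrature error on Chebyshev polynomials and powers. -/

open Chebyshev

theorem abs_error_T_le {Q : ℕ} (hQ : 1 ≤ Q) {ρ : ℝ} (hρ : 1 ≤ ρ) (k : ℤ) :
    |error Q (fun y => (T ℝ k).eval y)| ≤
      4 * ρ ^ (-2 * (Q : ℤ)) * (ρ ^ k + ρ ^ (-k)) := by
  have hρ0 : 0 < ρ := by linarith
  rcases lt_or_ge k.natAbs (2 * Q) with h | h
  · rw [error, quad_eval_of_degree_lt_two_mul (by rw [degree_T]; exact_mod_cast h), sub_self,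
      abs_zero]
    positivity
  · have h4 := abs_error_le hQ (f := fun y => (T ℝ k).eval y) (C := 1)
      (fun y hy => abs_eval_T_real_le_one k (abs_le.2 hy))
    -- As `|k| ≥ 2Q`, one of `k`, `-k` compensates the exponent `-2Q`.
    have h1 : 1 ≤ ρ ^ (-2 * (Q : ℤ)) * (ρ ^ k + ρ ^ (-k)) := by
      rw [mul_add, ← zpow_add₀ hρ0.ne', ← zpow_add₀ hρ0.ne']
      rcases le_or_gt 0 k with hk | hk
      · have := one_le_zpow₀ hρ (n := -2 * (Q : ℤ) + k) (by omega)
        have := zpow_pos hρ0 (-2 * (Q : ℤ) + -k)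
        linarith
      · have := one_le_zpow₀ hρ (n := -2 * (Q : ℤ) + -k) (by omega)
        have := zpow_pos hρ0 (-2 * (Q : ℤ) + k)
        linarith
    linarith

/-- `ρ^k + ρ^(-k)` obeys the Chebyshev recurrence with `y` replaced by `(ρ + ρ⁻¹)/2`, so the bound
propagates exactly. Integer indices avoid a special case at `k = 0`. -/
theorem abs_error_pow_mul_T_le {Q : ℕ} (hQ : 1 ≤ Q) {ρ : ℝ} (hρ : 1 ≤ ρ) (n : ℕ) (k : ℤ) :
    |error Q (fun y => y ^ n * (T ℝ k).eval y)| ≤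
      4 * ρ ^ (-2 * (Q : ℤ)) * ((ρ + ρ⁻¹) / 2) ^ n * (ρ ^ k + ρ ^ (-k)) := by
  have hρ0 : ρ ≠ 0 := by positivity
  induction n generalizing k with
  | zero => simpa using abs_error_T_le hQ hρ k
  | succ n ih =>
    have hrec : ∀ y : ℝ, y ^ (n + 1) * (T ℝ k).eval y =
        1 / 2 * (y ^ n * (T ℝ (k + 1)).eval y + y ^ n * (T ℝ (k - 1)).eval y) := by
      intro y
      rw [T_add_one]
      simp
      ring
    simp only [hrec]
    rw [error_const_mul, error_add (by fun_prop) (by fun_prop), abs_mul]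
    have h1 := ih (k + 1)
    have h2 := ih (k - 1)
    have h3 := abs_add_le (error Q fun y => y ^ n * (T ℝ (k + 1)).eval y)
      (error Q fun y => y ^ n * (T ℝ (k - 1)).eval y)
    have hid : 4 * ρ ^ (-2 * (Q : ℤ)) * ((ρ + ρ⁻¹) / 2) ^ (n + 1) * (ρ ^ k + ρ ^ (-k)) =
        1 / 2 * (4 * ρ ^ (-2 * (Q : ℤ)) * ((ρ + ρ⁻¹) / 2) ^ n * (ρ ^ (k + 1) + ρ ^ (-(k + 1))) +
        4 * ρ ^ (-2 * (Q : ℤ)) * ((ρ + ρ⁻¹) / 2) ^ n * (ρ ^ (k - 1) + ρ ^ (-(k - 1)))) := by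
      rw [neg_add, neg_sub, sub_eq_add_neg k 1, sub_eq_add_neg 1 k, zpow_add₀ hρ0 k 1,
        zpow_add₀ hρ0 (-k) (-1), zpow_add₀ hρ0 k (-1), zpow_add₀ hρ0 1 (-k), zpow_neg_one,
        zpow_one]
      ring
    rw [hid, abs_of_pos (by norm_num : (0 : ℝ) < 1 / 2)]
    linarith

theorem abs_error_neg_pow_le {Q : ℕ} (hQ : 1 ≤ Q) {ρ : ℝ} (hρ : 1 ≤ ρ) (n : ℕ) :
    |error Q (fun y => (-y) ^ n)| ≤ 8 * ρ ^ (-2 * (Q : ℤ)) * ((ρ + ρ⁻¹) / 2) ^ n := by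
  have h := abs_error_pow_mul_T_le hQ hρ n 0
  simp only [T_zero, eval_one, mul_one, zpow_zero, neg_zero] at h
  have h1 : (fun y : ℝ => (-y) ^ n) = fun y => (-1) ^ n * y ^ n := by
    funext y; rw [neg_pow]
  rw [h1, error_const_mul, abs_mul, abs_pow, abs_neg, abs_one, one_pow, one_mul]
  linarith

end GaussLegendre

end

/-! ### Series with nonnegative coefficients in powers of `-y`. -/

theorem GaussLegendre.abs_error_le_of_hasSum {ι : Type*} [Countable ι] {Q : ℕ} (hQ : 1 ≤ Q)
    {ρ : ℝ} (hρ : 1 ≤ ρ) {c : ι → ℝ} (hc : ∀ i, 0 ≤ c i) {d : ι → ℕ} {f : ℝ → ℝ}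
    (hf : ∀ y, |y| ≤ (ρ + ρ⁻¹) / 2 → HasSum (fun i => c i * (-y) ^ d i) (f y)) :
    |error Q f| ≤ 8 * ρ ^ (-2 * (Q : ℤ)) * f (-((ρ + ρ⁻¹) / 2)) := by
  have hρ0 : 0 < ρ := by linarith
  have hR : 1 ≤ (ρ + ρ⁻¹) / 2 := by
    have h1 : ρ * ρ⁻¹ = 1 := mul_inv_cancel₀ hρ0.ne'
    nlinarith [sq_nonneg (ρ - ρ⁻¹), inv_pos.2 hρ0]
  set R := (ρ + ρ⁻¹) / 2 with hRdef
  have hmem : ∀ y ∈ Set.Icc (-1 : ℝ) 1, |y| ≤ R := fun y hy => (abs_le.2 hy).trans hR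
  have hint : HasSum (fun i => ∫ y in (-1 : ℝ)..1, c i * (-y) ^ d i)
      (∫ y in (-1 : ℝ)..1, f y) := by
    have hs : Summable c := by
      -- At `y = -1` all powers of `-y` equal 1.
      simpa using (hf (-1) (hmem _ (by norm_num))).summable
    have hsub : ∀ y ∈ Set.uIoc (-1 : ℝ) 1, y ∈ Set.Icc (-1 : ℝ) 1 := by
      intro y hy
      rw [Set.uIoc_of_le (by norm_num)] at hy
      exact Set.Ioc_subset_Icc_self hy
    refine intervalIntegral.hasSum_integral_of_dominated_convergence (fun i _ => c i)
      (fun i => by fun_prop) (fun i => .of_forall fun y hy => ?_) (.of_forall fun _ _ => hs)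
      intervalIntegrable_const (.of_forall fun y hy => hf y (hmem y (hsub y hy)))
    rw [norm_mul, norm_pow, norm_neg, Real.norm_eq_abs, Real.norm_eq_abs, abs_of_nonneg (hc i)]
    exact mul_le_of_le_one_right (hc i) (pow_le_one₀ (abs_nonneg _) (abs_le.2 (hsub y hy)))
  have hquad : HasSum (fun i => quad Q (fun y => c i * (-y) ^ d i)) (quad Q f) :=
    hasSum_sum fun x hx => (hf x (hmem x (node_mem_Icc hx))).mul_left (weight Q x)
  have herr : HasSum (fun i => c i * error Q (fun y => (-y) ^ d i)) (error Q f) := by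
    simp only [← error_const_mul]
    exact hint.sub hquad
  have hval : HasSum (fun i => 8 * ρ ^ (-2 * (Q : ℤ)) * (c i * R ^ d i))
      (8 * ρ ^ (-2 * (Q : ℤ)) * f (-R)) := by
    have h := hf (-R) (by rw [abs_neg, abs_of_pos (by linarith)])
    simp only [neg_neg] at h
    exact h.mul_left _
  refine herr.norm_le_of_bounded hval fun i => ?_
  rw [norm_mul, Real.norm_eq_abs, Real.norm_eq_abs, abs_of_nonneg (hc i)]
  calc c i * |error Q fun y => (-y) ^ d i|
      ≤ c i * (8 * ρ ^ (-2 * (Q : ℤ)) * R ^ d i) :=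
        mul_le_mul_of_nonneg_left (abs_error_neg_pow_le hQ hρ (d i)) (hc i)
    _ = _ := by ring

theorem Ring.multichoose_nonneg {α : ℝ} (hα : 0 < α) (n : ℕ) : 0 ≤ Ring.multichoose α n := by
  have h := Ring.factorial_nsmul_multichoose_eq_ascPochhammer α n
  rw [Polynomial.ascPochhammer_smeval_eq_eval, nsmul_eq_mul] at h
  have h1 := ascPochhammer_pos n α hα
  rw [← h] at h1
  exact (pos_of_mul_pos_right h1 (by positivity)).le

theorem Real.hasSum_one_add_rpow_neg (α : ℝ) {u : ℝ} (hu : |u| < 1) :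
    HasSum (fun n : ℕ => Ring.multichoose α n * (-u) ^ n) ((1 + u) ^ (-α)) := by
  have h := (Real.one_div_one_sub_rpow_hasFPowerSeriesOnBall_zero α).hasSum (y := -u)
    (by simpa [enorm_eq_nnnorm, ← NNReal.coe_lt_coe] using hu)
  have h0 : 0 ≤ 1 + u := by linarith [neg_abs_le u]
  rw [Real.rpow_neg h0]
  simpa [Ring.multichoose_eq, FormalMultilinearSeries.ofScalars_apply_eq, mul_comm] using h

theorem Real.hasSum_exp_neg_mul (s y : ℝ) :
    HasSum (fun n : ℕ => s ^ n / n.factorial * (-y) ^ n) (Real.exp (-s * y)) := by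
  have h := NormedSpace.expSeries_div_hasSum_exp (-s * y)
  rw [← Real.exp_eq_exp_ℝ] at h
  refine (congrArg (HasSum · _) (funext fun n => ?_)).mpr h
  rw [neg_mul_comm, mul_pow]
  ring

/-- The product stays a double series; no collection by total degree is needed. -/
theorem hasSum_one_add_div_rpow_mul_exp {α s c y : ℝ} (hc : 0 < c)
    (hy : |y| < c) :
    HasSum (fun p : ℕ × ℕ => Ring.multichoose α p.1 / c ^ p.1 * (s ^ p.2 / p.2.factorial) *
      (-y) ^ (p.1 + p.2)) ((1 + y / c) ^ (-α) * Real.exp (-s * y)) := by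
  have hu : ∀ u, |u| < c → |u / c| < 1 := fun u hu => by
    rwa [abs_div, abs_of_pos hc, div_lt_one hc]
  have h1 := Real.hasSum_one_add_rpow_neg α (hu y hy)
  have h2 := Real.hasSum_exp_neg_mul s y
  have hsum : Summable fun p : ℕ × ℕ => (Ring.multichoose α p.1 * (-(y / c)) ^ p.1) *
      (s ^ p.2 / p.2.factorial * (-y) ^ p.2) :=
    summable_mul_of_summable_norm h1.summable.norm h2.summable.norm
  refine (congrArg (HasSum · _) (funext fun p => ?_)).mpr (h1.mul h2 hsum)
  rw [pow_add, ← neg_div, div_pow]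
  ring

/-! ### The function `g` and the error of the reference integrand. -/

theorem gFun_add_inv_div_two {ε B : ℝ} (hB : 0 < B) (hε : ε ≤ 1) :
    (gFun ε B + (gFun ε B)⁻¹) / 2 = 1 + 2 / B * (1 - ε) := by
  have h0 : 0 ≤ 2 / B * (1 - ε) := mul_nonneg (by positivity) (by linarith)
  unfold gFun
  set R := 1 + 2 / B * (1 - ε)
  have hR : 1 ≤ R := by linarith
  have hsq := Real.sq_sqrt (show 0 ≤ R ^ 2 - 1 by nlinarith)
  have : (R + √(R ^ 2 - 1))⁻¹ = R - √(R ^ 2 - 1) := by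
    refine inv_eq_of_mul_eq_one_right ?_
    linear_combination -hsq
  rw [this]; ring

theorem one_lt_gFun {ε B : ℝ} (hB : 0 < B) (hε : ε < 1) : 1 < gFun ε B := by
  have h0 : 0 < 2 / B * (1 - ε) := mul_pos (by positivity) (by linarith)
  have := Real.sqrt_nonneg ((1 + 2 / B * (1 - ε)) ^ 2 - 1)
  unfold gFun
  linarith

theorem gFun_one (B : ℝ) : gFun 1 B = 1 := by simp [gFun]

theorem continuous_gFun (B : ℝ) : Continuous fun ε => gFun ε B := by
  unfold gFun; fun_prop

theorem abs_error_referenceIntegrand_le {α B t a : ℝ} (hα₀ : 0 < α) (hα₁ : α < 1) (hB : 0 < B)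
    (ht : 0 ≤ t) (ha : 0 < a) {Q : ℕ} (hQ : 1 ≤ Q) {ε : ℝ} (hε : ε ∈ Set.Ioo (0 : ℝ) 1) :
    |GaussLegendre.error Q (referenceIntegrand α t a ((B + 1) * a))| ≤
      8 * gFun ε B ^ (-2 * (Q : ℤ)) *
        (B * a / (2 * Real.Gamma (1 - α)) * (a * ε) ^ (-α) * Real.exp (-t * a * ε)) := by
  have hΓ : 0 < Real.Gamma (1 - α) := Real.Gamma_pos_of_pos (by linarith)
  have hR := gFun_add_inv_div_two hB hε.2.le
  have hg := one_lt_gFun hB hε.2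
  -- The singularity `x = 0` sits at `y = -c`, so `c` is the radius up to which the series is used.
  set c : ℝ := 1 + 2 / B with hc
  have hc0 : 0 < c := by positivity
  set s := t * (B * a) / 2 with hs
  set K := B * a / (2 * Real.Gamma (1 - α)) * Real.exp (-a * t) * (B * a / 2 * c) ^ (-α) *
    Real.exp (-s) with hK
  have hRc : 1 + 2 / B * (1 - ε) < c := by
    have : 0 < 2 / B * ε := mul_pos (by positivity) hε.1
    rw [hc]; linarith
  have hform : ∀ y, |y| < c → referenceIntegrand α t a ((B + 1) * a) y =
      K * ((1 + y / c) ^ (-α) * Real.exp (-s * y)) := by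
    intro y hy
    have hy0 : 0 ≤ 1 + y / c := by
      have := (abs_lt.1 hy).1
      rw [← neg_le_iff_add_nonneg', le_div_iff₀ hc0]
      linarith
    have h1 : a + ((B + 1) * a - a) / 2 * (y + 1) = B * a / 2 * c * (1 + y / c) := by
      field_simp
      rw [hc]
      field_simp
      ring
    have h2 : Real.exp (-t * (y + 1) * ((B + 1) * a - a) / 2) =
        Real.exp (-s) * Real.exp (-s * y) := by
      rw [← Real.exp_add, hs]; congr 1; ring
    rw [referenceIntegrand, h1, h2, Real.mul_rpow (by positivity) hy0, hK]
    ring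
  have hval : referenceIntegrand α t a ((B + 1) * a) (-(1 + 2 / B * (1 - ε))) =
      B * a / (2 * Real.Gamma (1 - α)) * (a * ε) ^ (-α) * Real.exp (-t * a * ε) := by
    have h1 : a + ((B + 1) * a - a) / 2 * (-(1 + 2 / B * (1 - ε)) + 1) = a * ε := by
      field_simp; ring
    have h2 : Real.exp (-t * a * ε) = Real.exp (-a * t) *
        Real.exp (-t * (-(1 + 2 / B * (1 - ε)) + 1) * ((B + 1) * a - a) / 2) := by
      rw [← Real.exp_add]; congr 1; field_simp; ring
    rw [referenceIntegrand, h1, h2]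
    ring
  have := GaussLegendre.abs_error_le_of_hasSum hQ hg.le (ι := ℕ × ℕ)
    (c := fun p => K * (Ring.multichoose α p.1 / c ^ p.1 * (s ^ p.2 / p.2.factorial)))
    (d := fun p => p.1 + p.2) (f := referenceIntegrand α t a ((B + 1) * a))
    (fun p => by
      have := Ring.multichoose_nonneg hα₀ p.1
      positivity)
    (fun y hy => by
      rw [hR] at hy
      have hy' := hy.trans_lt hRc
      rw [hform y hy']
      simpa only [mul_assoc] using
        (hasSum_one_add_div_rpow_mul_exp hc0 hy').mul_left K)
  rwa [hR, hval] at this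

/-- The reciprocal extends continuously to `[0, 1]` and vanishes at both ends (`0 ^ α = 0`, `g(1, B)
= 1`), so its maximum is interior. -/
theorem exists_isLeast_errorFactor {α B : ℝ} (hα : 0 < α) (hB : 0 < B) (t l : ℝ) (Q : ℕ) :
    ∃ m : ℝ, IsLeast (errorFactor α B t l Q '' Set.Ioo 0 1) m := by
  set φ : ℝ → ℝ := fun ε =>
    (gFun ε B - 1) * gFun ε B ^ (2 * (Q : ℤ) - 1) * ε ^ α * Real.exp (t * l * ε) with hφ
  have hg1 : ∀ ε ∈ Set.Icc (0 : ℝ) 1, 1 ≤ gFun ε B := fun ε hε => by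
    rcases hε.2.eq_or_lt with rfl | h
    · exact (gFun_one B).ge
    · exact (one_lt_gFun hB h).le
  have hcont : ContinuousOn φ (Set.Icc 0 1) := by
    have hg := (continuous_gFun B).continuousOn (s := Set.Icc (0 : ℝ) 1)
    refine ((hg.sub continuousOn_const).mul (hg.zpow₀ _ fun ε hε => Or.inl ?_)).mul
      (continuousOn_id.rpow_const fun _ _ => Or.inr hα.le) |>.mul (by fun_prop)
    linarith [hg1 ε hε]
  have hpos : ∀ ε ∈ Set.Ioo (0 : ℝ) 1, 0 < φ ε := fun ε hε => by
    have h1 := one_lt_gFun hB hε.2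
    have h2 := Real.rpow_pos_of_pos hε.1 α
    have h3 : 0 < gFun ε B ^ (2 * (Q : ℤ) - 1) := zpow_pos (by linarith) _
    have h4 : 0 < gFun ε B - 1 := by linarith
    positivity
  have hinv : ∀ ε ∈ Set.Ioo (0 : ℝ) 1, errorFactor α B t l Q ε = (φ ε)⁻¹ := fun ε hε => by
    rw [errorFactor, hφ, Real.rpow_neg hε.1.le,
      show -2 * (Q : ℤ) + 1 = -(2 * (Q : ℤ) - 1) by ring, zpow_neg,
      show -t * l * ε = -(t * l * ε) by ring, Real.exp_neg]
    simp only [mul_inv, div_eq_mul_inv]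
    ring
  obtain ⟨x, hx, hmax⟩ := isCompact_Icc.exists_isMaxOn (Set.nonempty_Icc.2 zero_le_one) hcont
  have hhalf : (1 / 2 : ℝ) ∈ Set.Ioo (0 : ℝ) 1 := by norm_num
  have hφx : 0 < φ x := (hpos _ hhalf).trans_le (hmax (Set.Ioo_subset_Icc_self hhalf))
  have hx' : x ∈ Set.Ioo (0 : ℝ) 1 := by
    refine ⟨hx.1.lt_of_ne ?_, hx.2.lt_of_ne ?_⟩
    · rintro rfl
      simp [hφ, Real.zero_rpow hα.ne'] at hφx
    · rintro rfl
      simp [hφ, gFun_one] at hφx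
  refine ⟨_, ⟨x, hx', rfl⟩, ?_⟩
  rintro _ ⟨y, hy, rfl⟩
  rw [hinv x hx', hinv y hy]
  exact inv_anti₀ (hpos y hy) (hmax (Set.Ioo_subset_Icc_self hy))

/-! ### Change of variables and conclusion. -/

theorem kernelIntegral_eq_integral_referenceIntegrand (α t : ℝ) {a b : ℝ} (hab : a < b) :
    kernelIntegral α t a b = ∫ y in (-1 : ℝ)..1, referenceIntegrand α t a b y := by
  have hc : (b - a) / 2 ≠ 0 := (by linarith : 0 < (b - a) / 2).ne'
  have h := intervalIntegral.integral_comp_mul_add (a := (-1 : ℝ)) (b := 1)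
    (fun x => x ^ (-α) * Real.exp (-x * t)) hc (a + (b - a) / 2)
  rw [show (b - a) / 2 * -1 + (a + (b - a) / 2) = a by ring,
    show (b - a) / 2 * 1 + (a + (b - a) / 2) = b by ring, smul_eq_mul,
    eq_inv_mul_iff_mul_eq₀ hc] at h
  rw [kernelIntegral, ← h, ← intervalIntegral.integral_const_mul,
    ← intervalIntegral.integral_const_mul]
  refine intervalIntegral.integral_congr fun y _ => ?_
  have h1 : (b - a) / 2 * y + (a + (b - a) / 2) = a + (b - a) / 2 * (y + 1) := by ring
  have h2 : Real.exp (-(a + (b - a) / 2 * (y + 1)) * t) =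
      Real.exp (-a * t) * Real.exp (-t * (y + 1) * (b - a) / 2) := by
    rw [← Real.exp_add]; congr 1; ring
  simp only [referenceIntegrand, h1, h2]
  rw [one_div, div_mul_eq_div_div]
  ring

/-- Since `1 ≤ ρ / (ρ - 1)`, the bound obtained here is sharper than the stated one. -/
theorem zpow_neg_two_mul_le {ρ : ℝ} (hρ : 1 < ρ) (Q : ℕ) :
    ρ ^ (-2 * (Q : ℤ)) ≤ ρ ^ (-2 * (Q : ℤ) + 1) / (ρ - 1) := by
  have h0 : 0 < ρ := by linarith
  rw [zpow_add_one₀ h0.ne', le_div_iff₀ (by linarith)]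
  exact mul_le_mul_of_nonneg_left (by linarith) (zpow_pos h0 _).le

theorem mainTheorem7 (α : ℝ) (hα₀ : 0 < α) (hα₁ : α < 1) (B : ℝ) (hB : 1 ≤ B)
    (J : ℕ) (L : ℕ → ℝ) (hL₀ : 0 < L 0)
    (hL : ∀ i : ℕ, 1 ≤ i → i ≤ J → L i = (B + 1) * L (i - 1))
    (j : ℕ) (hj₁ : 1 ≤ j) (hjJ : j ≤ J) (Q : ℕ) (hQ : 1 ≤ Q) (t : ℝ) (ht : 0 ≤ t) :
    kernelIntegral α t (L (j - 1)) (L j) =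
        ∫ y in (-1 : ℝ)..1, referenceIntegrand α t (L (j - 1)) (L j) y ∧
      ∃ m : ℝ, IsLeast (errorFactor α B t (L (j - 1)) Q '' Set.Ioo 0 1) m ∧
        |GaussLegendre.error Q (referenceIntegrand α t (L (j - 1)) (L j))| ≤
          4 * B * L (j - 1) ^ (1 - α) / Real.Gamma (1 - α) * m := by
  have hB0 : 0 < B := by linarith
  have hpos : ∀ i ≤ J, 0 < L i := by
    intro i
    induction i with
    | zero => exact fun _ => hL₀
    | succ i ih =>
      intro hi
      rw [hL (i + 1) (by omega) hi, Nat.add_sub_cancel]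
      exact mul_pos (by linarith) (ih (by omega))
  have ha : 0 < L (j - 1) := hpos _ (by omega)
  rw [hL j hj₁ hjJ]
  set a := L (j - 1)
  refine ⟨kernelIntegral_eq_integral_referenceIntegrand α t (by nlinarith), ?_⟩
  obtain ⟨m, hm⟩ := exists_isLeast_errorFactor hα₀ hB0 t a Q
  refine ⟨m, hm, ?_⟩
  obtain ⟨ε, hε, rfl⟩ := hm.1
  refine (abs_error_referenceIntegrand_le hα₀ hα₁ hB0 ht ha hQ hε).trans ?_
  have hΓ : 0 < Real.Gamma (1 - α) := Real.Gamma_pos_of_pos (by linarith)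
  have hz := zpow_neg_two_mul_le (one_lt_gFun hB0 hε.2) Q
  have hεα := Real.rpow_pos_of_pos hε.1 (-α)
  have haα := Real.rpow_pos_of_pos ha (-α)
  have hK : 0 ≤ B * a / (2 * Real.Gamma (1 - α)) * (a * ε) ^ (-α) * Real.exp (-t * a * ε) := by
    rw [Real.mul_rpow ha.le hε.1.le]
    positivity
  refine (mul_le_mul_of_nonneg_right (mul_le_mul_of_nonneg_left hz (by norm_num)) hK).trans_eq ?_
  rw [errorFactor, Real.mul_rpow ha.le hε.1.le, sub_eq_add_neg 1 α, Real.rpow_add ha,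
    Real.rpow_one, ← sub_eq_add_neg 1 α]
  field_simp
  ring
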